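/- For integers $d\ge 1$ and $n\ge 0$ let $$T_d(n)=\{(x_1,\dots,x_d)\in\mathbb{Z}_{\ge 0}^d : x_1+\dots+x_d\le n-1\}\subset\mathbb{R}^d .$$ For an integer $k\ge 1$, a $k$-cover of $T_d(n)$ is a finite multiset of affine hyperplanes of $\mathbb{R}^d$ such that every point of $T_d(n)$ lies on at least $k$ of them, counted with multiplicity. Let $f(n,d,k)$ be the minimum cardinality, counted with multiplicity, of a $k$-cover of $T_d(n)$. Then the following asymptotic formulas hold for fixed integers $d,k$ as $n\to\infty$, where $O_{d,k}(1)$ denotes a quantity bounded in absolute value by a constant depending only on $d$ and $k$. (a) If $k\ge 2$ and $d\ge 2k-3$, then $$f(n,d,k)=\left(1+\frac{k-1}{d-k+2}\right)n+O_{d,k}(1).$$ (b) If $k\ge 3$ and $k-2\le d\le 2k-3$, then $$f(n,d,k)=\left(2+\frac{2k-3-d}{2d+3-k}\right)n+O_{d,k}(1).$$ -/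

import Mathlib

open scoped BigOperators Asymptotics

namespace TriangularGrid

/-- The triangular grid `T_d(n)`: the points of `ℝ^d` with nonnegative integer coordinates
whose sum is at most `n - 1`, i.e. less than `n`. -/
def grid (d n : ℕ) : Set (Fin d → ℝ) :=
  {x | ∃ a : Fin d → ℕ, ∑ i, a i < n ∧ x = fun i => (a i : ℝ)}

/-- An affine hyperplane of `ℝ^d`: the solution set of one nontrivial linear equation. -/
def IsHyperplane {d : ℕ} (H : Set (Fin d → ℝ)) : Prop :=
  ∃ (v : Fin d → ℝ) (c : ℝ), v ≠ 0 ∧ H = {x | ∑ i, v i * x i = c}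

open Classical in
/-- The number of members of the multiset `C` that contain the point `p`, with multiplicity. -/
noncomputable def coverCount {d : ℕ} (C : Multiset (Set (Fin d → ℝ))) (p : Fin d → ℝ) : ℕ :=
  C.countP (fun H => p ∈ H)

/-- `C` is a `k`-cover of `T_d(n)`: a (finite) multiset of affine hyperplanes that covers every
point of the grid at least `k` times. -/
def IsKCover (n d k : ℕ) (C : Multiset (Set (Fin d → ℝ))) : Prop :=
  (∀ H ∈ C, IsHyperplane H) ∧ ∀ p ∈ grid d n, k ≤ coverCount C p

/-- The minimum cardinality (with multiplicity) of a `k`-cover of `T_d(n)`. -/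
noncomputable def f (n d k : ℕ) : ℕ :=
  sInf {m : ℕ | ∃ C : Multiset (Set (Fin d → ℝ)), IsKCover n d k C ∧ Multiset.card C = m}

/-- In positive dimension `k`-covers exist, so the infimum defining `f` is a minimum. -/
theorem exists_isKCover (n d k : ℕ) (hd : 0 < d) :
    ∃ C : Multiset (Set (Fin d → ℝ)), IsKCover n d k C ∧ Multiset.card C = f n d k := by
  classical
  suffices h : ∃ C : Multiset (Set (Fin d → ℝ)), IsKCover n d k C by
    obtain ⟨C, hC⟩ := h
    exact Nat.sInf_mem
      (s := {m : ℕ | ∃ C : Multiset (Set (Fin d → ℝ)), IsKCover n d k C ∧ Multiset.card C = m})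
      ⟨Multiset.card C, C, hC, rfl⟩
  let e : Fin d := ⟨0, hd⟩
  let P : ℕ → Set (Fin d → ℝ) := fun j => {x | ∑ i, (Pi.single e (1 : ℝ) : Fin d → ℝ) i * x i = j}
  have hP : ∀ j x, x ∈ P j ↔ x e = j := by
    intro j x
    simp [P, Pi.single_apply]
  refine ⟨k • (Multiset.range n).map P, ?_, ?_⟩
  · intro H hH
    obtain ⟨j, -, rfl⟩ := Multiset.mem_map.1 (Multiset.mem_of_mem_nsmul hH)
    exact ⟨Pi.single e 1, j, by simp, rfl⟩
  · rintro p ⟨a, ha, rfl⟩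
    have hlt : a e < n :=
      lt_of_le_of_lt (Finset.single_le_sum (fun i _ => Nat.zero_le (a i)) (Finset.mem_univ e)) ha
    have h1 : 0 < ((Multiset.range n).map P).countP (fun H => (fun i => (a i : ℝ)) ∈ H) := by
      rw [Multiset.countP_pos]
      exact ⟨P (a e), Multiset.mem_map_of_mem _ (Multiset.mem_range.2 hlt), (hP _ _).2 rfl⟩
    unfold coverCount
    rw [Multiset.countP_nsmul]
    convert Nat.mul_le_mul_left k h1 using 1
    simp

end TriangularGrid

/-! Work in D = d + 1 homogeneous coordinates: nonnegative integers with sum N = n - 1. For the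
upper bounds, take the lowest a levels of every coordinate. A point loses one incidence for each
coordinate that is at least a, and fewer than d + 2 - k coordinates are when a is just above n / (d
+ 2 - k); this gives (a). For (b), superpose the lowest α and the lowest 2α levels, with α just
above n / (2d + 3 - k).

For the lower bounds, let S be the size of a cover and M_j the number of its equations in x_j alone.
If a is the first level x_j = a not used by them, then a ≤ M_j, and the other S - M_j members still
k-cover that slice, which has one coordinate less. Summing over j with ∑ M_j ≤ S gives
`HasSlope.step_one`; using also the first level occupied at most once gives `HasSlope.step_mixed`.

These recursions reproduce the exact slopes, starting from two boundary lines: D = 2k - 2 with slope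
2 and k = D + 1 with slope 3. There `IsCover.slope_step` removes two coordinates at once, by a slice
x_l = 0, x_j = b; the induction ends at segments and triangles. -/

namespace TriangularGrid
section LowerBound

open Finset
open scoped Classical

/-! ### Covers in homogeneous coordinates, their slices and levels. -/

section Setup

variable {ι κ : Type}

/-- The equation `∑ i, v i * x i = c` is equivalent to an equation in `x j` only. -/
def IsCoord (v : ι → ℝ) (j : ι) : Prop := ∃ r, ∀ i, i ≠ j → v i = r

/-- The equation `∑ i, v i * x i = c` is equivalent to `x j = a` on `∑ i, x i = N`. -/
def CoordAt (v : ι → ℝ) (c : ℝ) (N : ℕ) (j : ι) (a : ℕ) : Prop :=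
  ∃ r, (∀ i, i ≠ j → v i = r) ∧ (v j - r) * a = c - r * N

/-- The equation `∑ i, v i * x i = c` is equivalent to one in `x j` and `x m` with coefficients of
equal sign, which becomes `x j = a` for `x m = 0`. -/
def PosAt (v : ι → ℝ) (c : ℝ) (N : ℕ) (j m : ι) (a : ℕ) : Prop :=
  ∃ r, (∀ i, i ≠ j → i ≠ m → v i = r) ∧ 0 < (v j - r) * (v m - r) ∧ (v j - r) * a = c - r * N

/-- The equation `∑ i, v i * x i = c` is equivalent to one in `x j` and `x m` with coefficients of
opposite sign, which becomes `x j = a` for `x m = 0`. -/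
def NegAt (v : ι → ℝ) (c : ℝ) (N : ℕ) (j m : ι) (a : ℕ) : Prop :=
  ∃ r, (∀ i, i ≠ j → i ≠ m → v i = r) ∧ (v j - r) * (v m - r) < 0 ∧ (v j - r) * a = c - r * N

theorem ne_of_coord {v : ι → ℝ} {r : ℝ} {j : ι} (hnc : ∃ i j, v i ≠ v j)
    (hv : ∀ i, i ≠ j → v i = r) : v j ≠ r := by
  rintro hj
  have : ∀ i, v i = r := fun i => by
    by_cases h : i = j
    · rw [h, hj]
    · exact hv i h
  obtain ⟨a, b, hab⟩ := hnc
  exact hab (by rw [this a, this b])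

theorem CoordAt.isCoord {v : ι → ℝ} {c : ℝ} {N : ℕ} {j : ι} {a : ℕ} (h : CoordAt v c N j a) :
    IsCoord v j := ⟨h.choose, h.choose_spec.1⟩

/-- The number of members that are equations in `x j` only. -/
noncomputable def coordCount (s : Finset κ) (v : κ → ι → ℝ) (j : ι) : ℕ :=
  #{h ∈ s | IsCoord (v h) j}

theorem coordCount_le (s : Finset κ) (v : κ → ι → ℝ) (j : ι) : coordCount s v j ≤ #s :=
  Finset.card_filter_le _ _

variable [Fintype ι]

/-- A family of affine hyperplanes `∑ i, v h i * x i = c h`, indexed by the finite set `s`, covering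
each of the points `x : ι → ℕ` with `∑ i, x i = N` at least `k` times. The equations live on the
affine space `∑ i, x i = N`, on which they are nontrivial because `v h` is not constant. -/
structure IsCover (N k : ℕ) (s : Finset κ) (v : κ → ι → ℝ) (c : κ → ℝ) : Prop where
  nonconst : ∀ h ∈ s, ∃ i j, v h i ≠ v h j
  covers : ∀ x : ι → ℕ, ∑ i, x i = N → k ≤ #{h ∈ s | ∑ i, v h i * x i = c h}

/-- Every `k`-cover in `D` homogeneous coordinates has at least `σ * N - K` members. -/
def BoundWith (D k : ℕ) (σ K : ℝ) : Prop :=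
  ∀ (ι κ : Type) [Fintype ι] (s : Finset κ) (v : κ → ι → ℝ) (c : κ → ℝ) (N : ℕ),
    Fintype.card ι = D → IsCover N k s v c → σ * N - K ≤ #s

/-- `k`-covers in `D` homogeneous coordinates have at least `σ * N - O(1)` members. -/
def HasSlope (D k : ℕ) (σ : ℝ) : Prop := ∃ K, 0 ≤ K ∧ BoundWith D k σ K

theorem sum_mul_eq_of_pair {v : ι → ℝ} {r : ℝ} {j m : ι} (hjm : j ≠ m)
    (hv : ∀ i, i ≠ j → i ≠ m → v i = r) {x : ι → ℕ} {N : ℕ} (hx : ∑ i, x i = N) :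
    ∑ i, v i * x i = r * N + (v j - r) * x j + (v m - r) * x m := by
  have h1 : ∑ i, (v i - r) * x i = (v j - r) * x j + (v m - r) * x m :=
    Fintype.sum_eq_add j m hjm fun i hi => by rw [hv i hi.1 hi.2]; ring
  have h2 : ∑ i, (v i - r) * x i = ∑ i, v i * x i - r * N := by
    rw [← hx]; push_cast
    rw [Finset.mul_sum, ← Finset.sum_sub_distrib]
    exact Finset.sum_congr rfl fun i _ => by ring
  linarith

theorem sum_mul_eq_of_coord {v : ι → ℝ} {r : ℝ} {j : ι}
    (hv : ∀ i, i ≠ j → v i = r) {x : ι → ℕ} {N : ℕ} (hx : ∑ i, x i = N) :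
    ∑ i, v i * x i = r * N + (v j - r) * x j := by
  have h1 : ∑ i, (v i - r) * x i = (v j - r) * x j :=
    Fintype.sum_eq_single j fun i hi => by rw [hv i hi]; ring
  have h2 : ∑ i, (v i - r) * x i = ∑ i, v i * x i - r * N := by
    rw [← hx]; push_cast
    rw [Finset.mul_sum, ← Finset.sum_sub_distrib]
    exact Finset.sum_congr rfl fun i _ => by ring
  linarith

theorem CoordAt.eq_of_incident {v : ι → ℝ} {c : ℝ} {N : ℕ} {j : ι} {a : ℕ}
    (h : CoordAt v c N j a) (hnc : ∃ i j, v i ≠ v j) {x : ι → ℕ} (hx : ∑ i, x i = N)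
    (hi : ∑ i, v i * x i = c) : x j = a := by
  obtain ⟨r, hr, ha⟩ := h
  rw [sum_mul_eq_of_coord hr hx] at hi
  have h1 : (v j - r) * x j = (v j - r) * a := by linarith
  have h2 := mul_left_cancel₀ (sub_ne_zero.2 (ne_of_coord hnc hr)) h1
  exact_mod_cast h2

theorem IsCoord.coordAt {v : ι → ℝ} {c : ℝ} {N : ℕ} {j : ι}
    (h : IsCoord v j) {x : ι → ℕ} (hx : ∑ i, x i = N)
    (hi : ∑ i, v i * x i = c) : CoordAt v c N j (x j) := by
  obtain ⟨r, hr⟩ := h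
  refine ⟨r, hr, ?_⟩
  rw [sum_mul_eq_of_coord hr hx] at hi
  linarith

theorem CoordAt.level_unique {v : ι → ℝ} {c : ℝ} {N : ℕ} {j : ι} {a b : ℕ}
    (hnc : ∃ i j, v i ≠ v j) (ha : CoordAt v c N j a) (hb : CoordAt v c N j b) : a = b := by
  obtain ⟨r, hr, ha⟩ := ha
  obtain ⟨r', hr', hb⟩ := hb
  have h0 := ne_of_coord hnc hr
  have hex : ∃ i, i ≠ j := by
    by_contra! hcon
    obtain ⟨p, q, hpq⟩ := hnc
    exact hpq (by rw [hcon p, hcon q])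
  obtain ⟨i, hi⟩ := hex
  have hrr : r = r' := by rw [← hr i hi, ← hr' i hi]
  subst hrr
  have h2 := mul_left_cancel₀ (sub_ne_zero.2 h0) (ha.trans hb.symm)
  exact_mod_cast h2

theorem exists_ne_ne_ne (hD : 4 ≤ Fintype.card ι) (a b c : ι) : ∃ o, o ≠ a ∧ o ≠ b ∧ o ≠ c := by
  have : ∃ o, o ∉ ({a, b, c} : Finset ι) := by
    by_contra! h
    have h1 : (univ : Finset ι) ⊆ {a, b, c} := fun o _ => h o
    have h2 := (Finset.card_le_card h1).trans Finset.card_le_three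
    rw [Finset.card_univ] at h2
    omega
  simpa using this

theorem exists_ne_ne (hD : 3 ≤ Fintype.card ι) (a b : ι) : ∃ o, o ≠ a ∧ o ≠ b := by
  have : ∃ o, o ∉ ({a, b} : Finset ι) := by
    by_contra! h
    have h1 : (univ : Finset ι) ⊆ {a, b} := fun o _ => h o
    have h2 := (Finset.card_le_card h1).trans Finset.card_le_two
    rw [Finset.card_univ] at h2
    omega
  simpa using this

theorem PosAt.level_unique {v : ι → ℝ} {c : ℝ} {N : ℕ} {j m : ι} {a b : ℕ}
    (hD : 3 ≤ Fintype.card ι) (ha : PosAt v c N j m a) (hb : PosAt v c N j m b) : a = b := by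
  obtain ⟨r, hr, h0, ha⟩ := ha
  obtain ⟨r', hr', -, hb⟩ := hb
  obtain ⟨o, h1, h2⟩ := exists_ne_ne hD j m
  obtain rfl : r = r' := by rw [← hr o h1 h2, ← hr' o h1 h2]
  exact_mod_cast mul_left_cancel₀ (left_ne_zero_of_mul h0.ne') (ha.trans hb.symm)

theorem NegAt.level_unique {v : ι → ℝ} {c : ℝ} {N : ℕ} {j m : ι} {a b : ℕ}
    (hD : 3 ≤ Fintype.card ι) (ha : NegAt v c N j m a) (hb : NegAt v c N j m b) : a = b := by
  obtain ⟨r, hr, h0, ha⟩ := ha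
  obtain ⟨r', hr', -, hb⟩ := hb
  obtain ⟨o, h1, h2⟩ := exists_ne_ne hD j m
  obtain rfl : r = r' := by rw [← hr o h1 h2, ← hr' o h1 h2]
  exact_mod_cast mul_left_cancel₀ (left_ne_zero_of_mul h0.ne) (ha.trans hb.symm)

section Slice

variable {N k : ℕ} {s : Finset κ} {v : κ → ι → ℝ} {c : κ → ℝ}

/-- Fixing the coordinates outside `p` to the values `r` leaves a cover by the members of `s'`, where
the other members contain each point of the slice at most `m` times. -/
theorem IsCover.slice {m a : ℕ} (hC : IsCover N k s v c) (p : ι → Prop) (r : ι → ℕ)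
    (hra : ∑ i, r i = a) (haN : a ≤ N) {s' : Finset κ}
    (hnc : ∀ h ∈ s', ∃ i j, p i ∧ p j ∧ v h i ≠ v h j)
    (hm : ∀ x : ι → ℕ, ∑ i, x i = N → (∀ i, ¬ p i → x i = r i) →
      #{h ∈ s \ s' | ∑ i, v h i * x i = c h} ≤ m) :
    IsCover (ι := {i // p i}) (N - a) (k - m) s' (fun h i => v h i)
      (fun h => c h - ∑ i, v h i * r i) := by
  refine ⟨fun h hh => ?_, fun y hy => ?_⟩
  · obtain ⟨i, j, hi, hj, hij⟩ := hnc h hh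
    exact ⟨⟨i, hi⟩, ⟨j, hj⟩, hij⟩
  · let e : ι → ℕ := fun i => if hp : p i then y ⟨i, hp⟩ else 0
    have he : ∀ i : {i // p i}, e i = y i := fun i => by simp [e, i.2]
    have he0 : ∀ i, ¬ p i → e i = 0 := fun i hi => by simp [e, hi]
    have hesum : ∑ i, e i = N - a := by
      rw [← hy, ← Finset.sum_filter_of_ne (p := p) (fun i _ hne => by
        by_contra hi; exact hne (he0 i hi))]
      rw [Finset.sum_subtype (p := p) _ (by simp)]
      exact Finset.sum_congr rfl fun i _ => he i
    have hvsum : ∀ h, ∑ i, v h i * (e i : ℝ) = ∑ i : {i // p i}, v h i * (y i : ℝ) := fun h => by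
      rw [← Finset.sum_filter_of_ne (p := p) (fun i _ hne => by
        by_contra hi; exact hne (by simp [he0 i hi]))]
      rw [Finset.sum_subtype (p := p) _ (by simp)]
      exact Finset.sum_congr rfl fun i _ => by rw [he i]
    have hx : ∑ i, (r i + e i) = N := by
      rw [Finset.sum_add_distrib, hra, hesum]; omega
    have h1 := hC.covers _ hx
    have h2 := hm _ hx (fun i hi => by simp [he0 i hi])
    have h3 : #{h ∈ s | ∑ i, v h i * ((r i + e i : ℕ) : ℝ) = c h}
        ≤ #{h ∈ s' | ∑ i, v h i * ((r i + e i : ℕ) : ℝ) = c h}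
          + #{h ∈ s \ s' | ∑ i, v h i * ((r i + e i : ℕ) : ℝ) = c h} := by
      refine (Finset.card_le_card ?_).trans (Finset.card_union_le _ _)
      intro h hh
      simp only [mem_filter, mem_union, mem_sdiff] at hh ⊢
      tauto
    have h4 : {h ∈ s' | ∑ i, v h i * ((r i + e i : ℕ) : ℝ) = c h}
        = {h ∈ s' | ∑ i : {i // p i}, v h i * (y i : ℝ) = c h - ∑ i, v h i * (r i : ℝ)} := by
      refine Finset.filter_congr fun h _ => ?_
      rw [← hvsum h, eq_sub_iff_add_eq, ← Finset.sum_add_distrib]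
      refine Eq.congr (Finset.sum_congr rfl fun i _ => ?_) rfl
      push_cast; ring
    rw [h4] at h3
    omega

theorem BoundWith.le {D : ℕ} {σ K : ℝ} (hB : BoundWith D k σ K) {α : Type} {inst : Fintype α}
    {v : κ → α → ℝ} (hD : Fintype.card α = D) (hC : IsCover N k s v c) : σ * N - K ≤ #s :=
  hB α κ s v c N hD hC

/-- The number of members `x j = a`. -/
noncomputable def levelCount (N : ℕ) (s : Finset κ) (v : κ → ι → ℝ) (c : κ → ℝ) (j : ι) (a : ℕ) :
    ℕ := #{h ∈ s | CoordAt (v h) (c h) N j a}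

/-- On the slice x j = a, an equation in x j alone is incident only if it is that very level, so
these equations contribute at most m and the other members cover the slice k times. -/
theorem IsCover.le_sub_coordCount {D k m a : ℕ} {σ K : ℝ} (hB : BoundWith D k σ K) (hσ : 0 ≤ σ)
    (hK : 0 ≤ K) (hD : Fintype.card ι = D + 1) (hC : IsCover N (k + m) s v c) (j : ι)
    (hw : levelCount N s v c j a ≤ m) :
    σ * ((N : ℝ) - a) - K ≤ (#s : ℝ) - coordCount s v j := by
  rcases lt_or_ge N a with ha | ha
  · have h1 : (coordCount s v j : ℝ) ≤ #s := by exact_mod_cast coordCount_le s v j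
    have h2 : (N : ℝ) - a ≤ 0 := by
      have : (N : ℝ) < a := by exact_mod_cast ha
      linarith
    have h3 := mul_nonpos_of_nonneg_of_nonpos hσ h2
    linarith
  · have hS := hC.slice (m := m) (a := a) (fun i => i ≠ j) (Pi.single j a)
      (by simp) ha (s' := {h ∈ s | ¬ IsCoord (v h) j}) (fun h hh => by
        have h1 := (Finset.mem_filter.1 hh).2
        by_contra! hcon
        apply h1
        by_cases hex : ∃ i, i ≠ j
        · obtain ⟨i, hi⟩ := hex
          exact ⟨v h i, fun i' hi' => hcon i' i hi' hi⟩
        · exact ⟨0, fun i hi => (hex ⟨i, hi⟩).elim⟩)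
      (fun x hx hxr => by
        refine le_trans (Finset.card_le_card fun h hh => ?_) hw
        simp only [mem_filter, mem_sdiff, not_and, not_not] at hh ⊢
        have := (hh.1.2 hh.1.1).coordAt hx hh.2
        rw [hxr j (by simp)] at this
        simp only [Pi.single_eq_same] at this
        exact ⟨hh.1.1, this⟩)
    rw [Nat.add_sub_cancel] at hS
    have hcard : Fintype.card {i // i ≠ j} = D := by
      rw [Fintype.card_subtype_compl]; simp [hD]
    have h1 := hB.le (by convert hcard) hS
    rw [Nat.cast_sub ha] at h1
    have h2 : #{h ∈ s | ¬ IsCoord (v h) j} + coordCount s v j = #s := by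
      rw [add_comm]; exact Finset.card_filter_add_card_filter_not _
    have h3 : (#{h ∈ s | ¬ IsCoord (v h) j} : ℝ) + coordCount s v j = #s := by exact_mod_cast h2
    linarith

theorem card_le_card_of_witness {α β : Type*} (R : β → α → Prop) {A : Finset α} {F : Finset β}
    (hex : ∀ a ∈ A, ∃ h ∈ F, R h a) (huniq : ∀ h ∈ F, ∀ a b, R h a → R h b → a = b) :
    #A ≤ #F := by
  refine Finset.card_le_card_of_forall_subsingleton (fun a h => R h a) hex ?_
  exact fun h hh a ha b hb => huniq h hh a b ha.2 hb.2

theorem IsCover.sum_levelCount_le (hC : IsCover N k s v c) (j : ι) (A : Finset ℕ) :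
    ∑ a ∈ A, levelCount N s v c j a ≤ coordCount s v j := by
  unfold levelCount
  rw [← Finset.card_biUnion]
  · refine Finset.card_le_card fun h hh => ?_
    simp only [mem_biUnion, mem_filter] at hh ⊢
    obtain ⟨a, -, hs, ha⟩ := hh
    exact ⟨hs, ha.isCoord⟩
  · intro a _ b _ hab
    refine Finset.disjoint_filter.2 fun h hh ha hb => hab ?_
    exact ha.level_unique (hC.nonconst h hh) hb

theorem IsCover.exists_levelCount_eq_zero (hC : IsCover N k s v c) (j : ι) :
    ∃ a, levelCount N s v c j a = 0 := by
  by_contra! hcon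
  have h1 := hC.sum_levelCount_le j (range (coordCount s v j + 1))
  have h2 : ∑ a ∈ range (coordCount s v j + 1), 1 ≤
      ∑ a ∈ range (coordCount s v j + 1), levelCount N s v c j a :=
    Finset.sum_le_sum fun a _ => Nat.one_le_iff_ne_zero.2 (hcon a)
  simp at h2
  omega

/-- With three coordinates, a nonconstant equation involves at most one coordinate alone; with two,
it is of both kinds. -/
theorem IsCover.sum_coordCount_le (hC : IsCover N k s v c) (hD : 3 ≤ Fintype.card ι) :
    ∑ j, coordCount s v j ≤ #s := by
  unfold coordCount
  rw [← Finset.card_biUnion]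
  · exact Finset.card_le_card (Finset.biUnion_subset.2 fun j _ => Finset.filter_subset _ _)
  · intro a _ b _ hab
    refine Finset.disjoint_filter.2 fun h hh ha hb => ?_
    obtain ⟨r, hr⟩ := ha
    obtain ⟨r', hr'⟩ := hb
    obtain ⟨o, h1, h2⟩ := exists_ne_ne hD a b
    refine ne_of_coord (hC.nonconst h hh) hr ?_
    rw [hr' a hab, ← hr' o h2, hr o h1]

/-- Increasing one coordinate turns a cover for `N + 1` into a cover for `N`. -/
theorem IsCover.peel (hC : IsCover (N + 1) k s v c) (i : ι) :
    IsCover N k {h ∈ s | ¬ CoordAt (v h) (c h) (N + 1) i 0} v (fun h => c h - v h i) := by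
  refine ⟨fun h hh => hC.nonconst h (Finset.mem_filter.1 hh).1, fun y hy => ?_⟩
  have hx : ∑ l, (y l + (Pi.single i 1 : ι → ℕ) l) = N + 1 := by
    rw [Finset.sum_add_distrib, hy]; simp
  refine (hC.covers _ hx).trans (Finset.card_le_card fun h hh => ?_)
  simp only [mem_filter] at hh ⊢
  refine ⟨⟨hh.1, fun h0 => ?_⟩, ?_⟩
  · have := h0.eq_of_incident (hC.nonconst h hh.1) hx hh.2
    simp at this
  · have h2 := hh.2
    push_cast at h2
    simp only [mul_add, Finset.sum_add_distrib] at h2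
    have h3 : ∑ l, v h l * ((Pi.single i 1 : ι → ℕ) l : ℝ) = v h i := by
      rw [Fintype.sum_eq_single i fun l hl => by simp [hl]]; simp
    linarith

end Slice

end Setup

/-! ### Equations in two coordinates. -/

section Pairs

variable {ι κ : Type} [Fintype ι] {N k : ℕ} {s : Finset κ}

/-- The N + 1 points lie on a segment, and each nontrivial equation holds at no more than one of
them; count incidences. -/
theorem boundWith_two (k : ℕ) : BoundWith 2 k k 0 := by
  intro ι κ _ s v c N hD hC
  rw [← Finset.card_univ, Finset.card_eq_two] at hD
  obtain ⟨i, j, hij, huniv⟩ := hD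
  have hsum : ∀ {M : Type} [AddCommMonoid M] (g : ι → M), ∑ l, g l = g i + g j := fun g => by
    rw [huniv, Finset.sum_pair hij]
  let x : ℕ → ι → ℕ := fun a l => if l = i then a else N - a
  have hxi : ∀ a, x a i = a := fun a => by simp [x]
  have hxj : ∀ a, x a j = N - a := fun a => by simp [x, hij.symm]
  have h1 := Finset.card_mul_le_card_mul (s := range (N + 1)) (t := s) (m := k) (n := 1)
    (fun a h => ∑ l, v h l * x a l = c h)
    (fun a ha => hC.covers (x a) (by
      rw [hsum, hxi, hxj]; have := Finset.mem_range.1 ha; omega))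
    (fun h hh => by
      refine Finset.card_le_one.2 fun a ha b hb => ?_
      simp only [bipartiteBelow, mem_filter, mem_range] at ha hb
      have ha2 := ha.2
      have hb2 := hb.2
      rw [hsum, hxi, hxj, Nat.cast_sub (by omega)] at ha2 hb2
      have hne : v h i ≠ v h j := by
        obtain ⟨p, q, hpq⟩ := hC.nonconst h hh
        have hp := Finset.mem_univ p
        have hq := Finset.mem_univ q
        rw [huniv] at hp hq
        simp only [mem_insert, mem_singleton] at hp hq
        rcases hp with rfl | rfl <;> rcases hq with rfl | rfl
        · exact (hpq rfl).elim
        · exact hpq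
        · exact hpq.symm
        · exact (hpq rfl).elim
      have h3 : (v h i - v h j) * a = (v h i - v h j) * b := by linarith
      exact_mod_cast mul_left_cancel₀ (sub_ne_zero.2 hne) h3)
  have h2 : (((#(range (N + 1)) * k : ℕ) : ℝ)) ≤ ((#s * 1 : ℕ) : ℝ) := by exact_mod_cast h1
  push_cast [Finset.card_range] at h2
  have : (0 : ℝ) ≤ k := Nat.cast_nonneg k
  linarith

section Single

variable {v : ι → ℝ} {c : ℝ} {x : ι → ℕ} {j l m a b : ι}

theorem coordAt_or_of_incident {b : ℕ} (hjl : j ≠ l)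
    (hv : ∃ r, ∀ i, i ≠ j → i ≠ l → v i = r) (hx : ∑ i, x i = N)
    (hl : x l = 0) (hj : x j = b) (hi : ∑ i, v i * x i = c) :
    CoordAt v c N l 0 ∨ CoordAt v c N j b ∨ PosAt v c N j l b ∨ NegAt v c N j l b := by
  obtain ⟨r, hr⟩ := hv
  have h1 := sum_mul_eq_of_pair hjl hr hx
  rw [hi, hl, hj, Nat.cast_zero, mul_zero, add_zero] at h1
  have h2 : (v j - r) * b = c - r * N := by linarith
  by_cases h3 : v j = r
  · refine Or.inl ⟨r, fun i hi => ?_, ?_⟩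
    · by_cases hij : i = j
      · rw [hij, h3]
      · exact hr i hij hi
    · rw [← h2, h3]; simp
  by_cases h4 : v l = r
  · refine Or.inr (Or.inl ⟨r, fun i hi => ?_, h2⟩)
    by_cases hij : i = l
    · rw [hij, h4]
    · exact hr i hi hij
  rcases lt_or_gt_of_ne (mul_ne_zero (sub_ne_zero.2 h3) (sub_ne_zero.2 h4)) with h5 | h5
  · exact Or.inr (Or.inr (Or.inr ⟨r, hr, h5, h2⟩))
  · exact Or.inr (Or.inr (Or.inl ⟨r, hr, h5, h2⟩))

/-- With opposite signs, x l grows with x m from its value a ≥ 1 at x m = 0, so the member misses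
the whole facet x l = 0. -/
theorem NegAt.not_incident {a : ℕ} (h : NegAt v c N l m a) (hlm : l ≠ m) (ha : 1 ≤ a)
    (hx : ∑ i, x i = N) (hl : x l = 0) : ∑ i, v i * x i ≠ c := by
  obtain ⟨r, hr, hneg, hc⟩ := h
  intro hi
  rw [sum_mul_eq_of_pair hlm hr hx, hl, Nat.cast_zero, mul_zero] at hi
  have h1 : (v l - r) * a = (v m - r) * x m := by linarith
  have h2 : (v l - r) * (v l - r) * a = (v l - r) * (v m - r) * x m := by
    rw [mul_assoc, h1, mul_assoc]
  have h3 : 0 < (v l - r) * (v l - r) := mul_self_pos.2 (left_ne_zero_of_mul hneg.ne)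
  have h4 : (1 : ℝ) ≤ a := by exact_mod_cast ha
  have h5 : (0 : ℝ) ≤ x m := Nat.cast_nonneg _
  nlinarith

/-- With equal signs, the intercept is the largest value of x j on the hyperplane. -/
theorem PosAt.not_incident {a : ℕ} (h : PosAt v c N j m a) (hjm : j ≠ m) (hj : a < x j)
    (hx : ∑ i, x i = N) : ∑ i, v i * x i ≠ c := by
  obtain ⟨r, hr, hpos, hc⟩ := h
  intro hi
  rw [sum_mul_eq_of_pair hjm hr hx] at hi
  have h1 : (v j - r) * (x j - a) = - ((v m - r) * x m) := by linarith
  have h2 : (v j - r) * (v j - r) * (x j - a) = - ((v j - r) * (v m - r) * x m) := by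
    rw [mul_assoc, h1]; ring
  have h3 : 0 < (v j - r) * (v j - r) := mul_self_pos.2 (left_ne_zero_of_mul hpos.ne')
  have h4 : (0 : ℝ) < x j - a := sub_pos.2 (by exact_mod_cast hj)
  have h5 : (0 : ℝ) ≤ x m := Nat.cast_nonneg _
  have := mul_pos h3 h4
  have := mul_nonneg hpos.le h5
  linarith

theorem not_isCoord_of_pair {r : ℝ} (hD : 4 ≤ Fintype.card ι) (hjm : j ≠ m)
    (hr : ∀ i, i ≠ j → i ≠ m → v i = r) (hne : (v j - r) * (v m - r) ≠ 0) : ¬ IsCoord v l := by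
  rintro ⟨r', hr'⟩
  obtain ⟨o, h1, h2, h3⟩ := exists_ne_ne_ne hD j m l
  obtain rfl : r = r' := by rw [← hr o h1 h2, ← hr' o h3]
  have h4 : l = j := by
    by_contra h
    exact left_ne_zero_of_mul hne (sub_eq_zero.2 (hr' j (Ne.symm h)))
  have h5 : l = m := by
    by_contra h
    exact right_ne_zero_of_mul hne (sub_eq_zero.2 (hr' m (Ne.symm h)))
  exact hjm (h4.symm.trans h5)

theorem pair_partner_unique {r r' : ℝ} (hD : 4 ≤ Fintype.card ι) (hjm : j ≠ m)
    (hr : ∀ i, i ≠ j → i ≠ m → v i = r) (hne : (v j - r) * (v m - r) ≠ 0)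
    (hr' : ∀ i, i ≠ j → i ≠ l → v i = r') : m = l := by
  by_contra hml
  obtain ⟨o, h1, h2, h3⟩ := exists_ne_ne_ne hD j m l
  obtain rfl : r = r' := by rw [← hr o h1 h2, ← hr' o h1 h3]
  exact right_ne_zero_of_mul hne (sub_eq_zero.2 (hr' m hjm.symm hml))

theorem NegAt.not_posAt {l' : ι} {a b : ℕ} (hD : 4 ≤ Fintype.card ι) (hll : l ≠ l') (hjm : j ≠ m)
    (hn : NegAt v c N l l' a) (hp : PosAt v c N j m b) : False := by
  obtain ⟨r, hr, hneg, -⟩ := hn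
  obtain ⟨r', hr', hpos, -⟩ := hp
  by_cases hrr : r = r'
  · subst hrr
    have h1 : l = j ∨ l = m := by
      by_contra! h
      exact left_ne_zero_of_mul hneg.ne (sub_eq_zero.2 (hr' l h.1 h.2))
    have h2 : l' = j ∨ l' = m := by
      by_contra! h
      exact right_ne_zero_of_mul hneg.ne (sub_eq_zero.2 (hr' l' h.1 h.2))
    rcases h1 with rfl | rfl <;> rcases h2 with rfl | rfl
    · exact hll rfl
    · linarith
    · rw [mul_comm] at hneg; linarith
    · exact hll rfl
  have key : ∀ o, o ≠ l → o ≠ l' → o ≠ j → o ≠ m → False := fun o h1 h2 h3 h4 =>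
    hrr (by rw [← hr o h1 h2, ← hr' o h3 h4])
  by_cases h1 : l = j ∨ l = m
  · obtain ⟨o, h2, h3, h4⟩ := exists_ne_ne_ne hD l' j m
    exact key o (by rcases h1 with rfl | rfl <;> assumption) h2 h3 h4
  by_cases h2 : l' = j ∨ l' = m
  · obtain ⟨o, h3, h4, h5⟩ := exists_ne_ne_ne hD l j m
    exact key o h3 (by rcases h2 with rfl | rfl <;> assumption) h4 h5
  push Not at h1 h2
  rw [hr' l h1.1 h1.2, hr' l' h2.1 h2.2] at hneg
  exact absurd hneg (not_lt.2 (mul_self_nonneg _))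

end Single

end Pairs

/-! ### Slices of codimension two. -/

variable {ι κ : Type} [Fintype ι] {N k : ℕ} {s : Finset κ} {v : κ → ι → ℝ} {c : κ → ℝ}

/-- The members that are equations in `x i` and another coordinate, with coefficients of opposite
sign and positive intercept with the `x i`-axis. -/
noncomputable def negSet (N : ℕ) (s : Finset κ) (v : κ → ι → ℝ) (c : κ → ℝ) (i : ι) : Finset κ :=
  {h ∈ s | ∃ m, i ≠ m ∧ ∃ a, 1 ≤ a ∧ NegAt (v h) (c h) N i m a}

/-- No equation in `x j` and `x l` among the members has intercept `a` with the `x j`-axis. -/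
def Uncovered (N : ℕ) (s : Finset κ) (v : κ → ι → ℝ) (c : κ → ℝ) (j l : ι) (a : ℕ) : Prop :=
  levelCount N s v c j a = 0 ∧
    ∀ h ∈ s, ¬ PosAt (v h) (c h) N j l a ∧ ¬ NegAt (v h) (c h) N j l a

/-- The members missing the slice `x l = 0`, `x j = b` are not needed to cover it. -/
theorem IsCover.le_sub_card {D m b : ℕ} {σ K : ℝ} (hB : BoundWith D k σ K)
    (hD : Fintype.card ι = D + 2) (hC : IsCover N (k + m) s v c) {j l : ι} (hjl : j ≠ l)
    (hbN : b ≤ N) (hunc : Uncovered N s v c j l b) (hw : levelCount N s v c l 0 ≤ m)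
    {R : Finset κ} (hRs : R ⊆ s)
    (hR : ∀ h ∈ R, IsCoord (v h) j ∨ IsCoord (v h) l ∨ h ∈ negSet N s v c l ∨
      ∃ m, j ≠ m ∧ ∃ a < b, PosAt (v h) (c h) N j m a) :
    σ * ((N : ℝ) - b) - K ≤ (#s : ℝ) - #R := by
  have hbj : ∀ h ∈ s, ¬ CoordAt (v h) (c h) N j b := fun h hh hb => by
    have := hunc.1
    rw [levelCount, Finset.card_eq_zero] at this
    exact Finset.notMem_empty h (this ▸ Finset.mem_filter.2 ⟨hh, hb⟩)
  have hS := hC.slice (m := m) (a := b) (fun i => i ≠ j ∧ i ≠ l) (Pi.single j b) (by simp) hbN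
    (s' := {h ∈ s | (¬ ∃ r, ∀ i, i ≠ j → i ≠ l → v h i = r) ∧ h ∉ R}) (fun h hh => by
      have h1 := (Finset.mem_filter.1 hh).2.1
      by_contra! hcon
      apply h1
      by_cases hex : ∃ i, i ≠ j ∧ i ≠ l
      · obtain ⟨i, hi⟩ := hex
        exact ⟨v h i, fun i' h2 h3 => hcon i' i ⟨h2, h3⟩ hi⟩
      · exact ⟨0, fun i h2 h3 => (hex ⟨i, h2, h3⟩).elim⟩)
    (fun x hx hxr => by
      have hxj : x j = b := by rw [hxr j (by simp)]; simp
      have hxl : x l = 0 := by rw [hxr l (by simp)]; simp [hjl.symm]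
      refine le_trans (Finset.card_le_card fun h hh => ?_) hw
      simp only [mem_filter, mem_sdiff, not_and] at hh ⊢
      obtain ⟨⟨hs, hh⟩, hi⟩ := hh
      refine ⟨hs, ?_⟩
      -- An incident member outside the retained family must be x l = 0: `hunc` excludes all other
      -- equations in x j and x l, and each remaining kind in R misses the slice.
      by_cases hpair : ∃ r, ∀ i, i ≠ j → i ≠ l → v h i = r
      · rcases coordAt_or_of_incident hjl hpair hx hxl hxj hi with h1 | h1 | h1 | h1
        · exact h1
        · exact (hbj h hs h1).elim
        · exact ((hunc.2 h hs).1 h1).elim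
        · exact ((hunc.2 h hs).2 h1).elim
      · rcases hR h (not_not.1 (hh hs hpair)) with h1 | h1 | h1 | ⟨m, hm, a, ha, h1⟩
        · exact (hbj h hs (hxj ▸ h1.coordAt hx hi)).elim
        · exact hxl ▸ h1.coordAt hx hi
        · obtain ⟨m, hm, a, ha, h2⟩ := (Finset.mem_filter.1 h1).2
          exact (h2.not_incident hm ha hx hxl hi).elim
        · exact (h1.not_incident hm (hxj ▸ ha) hx hi).elim)
  rw [Nat.add_sub_cancel] at hS
  have hcard : Fintype.card {i // i ≠ j ∧ i ≠ l} = D := by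
    have h1 : ({i | i ≠ j ∧ i ≠ l} : Finset ι) = (univ.erase j).erase l := by
      ext i; simp [and_comm]
    rw [Fintype.card_subtype, h1, Finset.card_erase_of_mem (by simp [hjl.symm]),
      Finset.card_erase_of_mem (by simp), Finset.card_univ, hD]
    rfl
  have h1 := hB.le (by convert hcard) hS
  rw [Nat.cast_sub hbN] at h1
  have h2 : #{h ∈ s | (¬ ∃ r, ∀ i, i ≠ j → i ≠ l → v h i = r) ∧ h ∉ R} + #R ≤ #s := by
    rw [← Finset.card_sdiff_add_card_eq_card hRs]
    gcongr
    intro h hh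
    simp only [mem_filter, mem_sdiff] at hh ⊢
    tauto
  have h3 : (#{h ∈ s | (¬ ∃ r, ∀ i, i ≠ j → i ≠ l → v h i = r) ∧ h ∉ R} : ℝ) + #R ≤ #s := by
    exact_mod_cast h2
  linarith

/-- The members that can be discarded on the slice `x l = 0`, `x j = b`. -/
noncomputable def discarded (N : ℕ) (s : Finset κ) (v : κ → ι → ℝ) (c : κ → ℝ) (j l : ι) (b : ℕ)
    (T : Finset ι) : Finset κ :=
  ({h ∈ s | IsCoord (v h) j} ∪ {h ∈ s | IsCoord (v h) l}) ∪
    (negSet N s v c l ∪ T.biUnion fun m => {h ∈ s | ∃ a < b, PosAt (v h) (c h) N j m a})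

theorem discarded_subset {j l : ι} {b : ℕ} {T : Finset ι} : discarded N s v c j l b T ⊆ s := by
  refine Finset.union_subset (Finset.union_subset (Finset.filter_subset _ _)
    (Finset.filter_subset _ _)) (Finset.union_subset (Finset.filter_subset _ _) ?_)
  exact Finset.biUnion_subset.2 fun m _ => Finset.filter_subset _ _

theorem IsCover.card_discarded (hC : IsCover N k s v c) (hD : 4 ≤ Fintype.card ι) {j l : ι}
    (hjl : j ≠ l) (b : ℕ) {T : Finset ι} (hT : j ∉ T) :
    #(discarded N s v c j l b T) = coordCount s v j + coordCount s v l + (#(negSet N s v c l) +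
      ∑ m ∈ T, #{h ∈ s | ∃ a < b, PosAt (v h) (c h) N j m a}) := by
  have hne : ∀ {m}, m ∈ T → j ≠ m := fun hm h => hT (h ▸ hm)
  have hneg : ∀ h ∈ negSet N s v c l, ∀ i, ¬ IsCoord (v h) i := fun h hh i => by
    obtain ⟨m, hm, a, ha, r, hr, h0, -⟩ := (Finset.mem_filter.1 hh).2
    exact not_isCoord_of_pair hD hm hr h0.ne
  have hpos : ∀ h ∈ T.biUnion fun m => {h ∈ s | ∃ a < b, PosAt (v h) (c h) N j m a},
      ∀ i, ¬ IsCoord (v h) i := fun h hh i => by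
    obtain ⟨m, hm, hh⟩ := Finset.mem_biUnion.1 hh
    obtain ⟨a, ha, r, hr, h0, -⟩ := (Finset.mem_filter.1 hh).2
    exact not_isCoord_of_pair hD (hne hm) hr h0.ne'
  rw [discarded, Finset.card_union_of_disjoint, Finset.card_union_of_disjoint,
    Finset.card_union_of_disjoint, Finset.card_biUnion]
  · rfl
  · intro m hm m' hm' hmm
    refine Finset.disjoint_filter.2 ?_
    rintro h - ⟨a, -, r, hr, h0, -⟩ ⟨a', -, r', hr', -, -⟩
    exact hmm (pair_partner_unique hD (hne hm) hr h0.ne' hr')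
  · refine Finset.disjoint_left.2 fun h hh hh' => ?_
    obtain ⟨m, hm, a, ha, h1⟩ := (Finset.mem_filter.1 hh).2
    obtain ⟨m', hm', hh'⟩ := Finset.mem_biUnion.1 hh'
    obtain ⟨a', ha', h2⟩ := (Finset.mem_filter.1 hh').2
    exact h1.not_posAt hD hm (hne hm') h2
  · refine Finset.disjoint_filter.2 ?_
    rintro h hh ⟨r, hr⟩ ⟨r', hr'⟩
    obtain ⟨o, h1, h2⟩ := exists_ne_ne (by omega) j l
    exact ne_of_coord (hC.nonconst h hh) hr (by rw [hr' j hjl, ← hr' o h2, hr o h1])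
  · refine Finset.disjoint_left.2 fun h hh hh' => ?_
    have h1 : IsCoord (v h) j ∨ IsCoord (v h) l := by
      rcases Finset.mem_union.1 hh with h1 | h1
      · exact Or.inl (Finset.mem_filter.1 h1).2
      · exact Or.inr (Finset.mem_filter.1 h1).2
    rcases Finset.mem_union.1 hh' with h2 | h2
    · exact h1.elim (hneg h h2 j) (hneg h h2 l)
    · exact h1.elim (hpos h h2 j) (hpos h h2 l)

theorem sum_card_negAt_le (hD : 4 ≤ Fintype.card ι) {j : ι} {T : Finset ι} (hT : j ∉ T) :
    ∑ m ∈ T, #{h ∈ s | ∃ a, 1 ≤ a ∧ NegAt (v h) (c h) N j m a} ≤ #(negSet N s v c j) := by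
  have hne : ∀ {m}, m ∈ T → j ≠ m := fun hm h => hT (h ▸ hm)
  rw [← Finset.card_biUnion]
  · refine Finset.card_le_card (Finset.biUnion_subset.2 fun m hm h hh => ?_)
    obtain ⟨hs, hh⟩ := Finset.mem_filter.1 hh
    exact Finset.mem_filter.2 ⟨hs, m, hne hm, hh⟩
  · intro m hm m' hm' hmm
    refine Finset.disjoint_filter.2 ?_
    rintro h - ⟨a, -, r, hr, h0, -⟩ ⟨a', -, r', hr', -, -⟩
    exact hmm (pair_partner_unique hD (hne hm) hr h0.ne hr')

/-- Below the first uncovered intercept, each intercept is used by some member. -/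
theorem sub_one_le_of_covered (hD : 3 ≤ Fintype.card ι) {j m : ι} {b : ℕ}
    (hb : ∀ a, 1 ≤ a → a < b → ¬ Uncovered N s v c j m a) :
    b - 1 ≤ #{a ∈ Ico 1 b | 1 ≤ levelCount N s v c j a} +
      #{h ∈ s | ∃ a, 1 ≤ a ∧ NegAt (v h) (c h) N j m a} +
      #{h ∈ s | ∃ a < b, PosAt (v h) (c h) N j m a} := by
  have h1 : #{a ∈ Ico 1 b | ∃ h ∈ s, NegAt (v h) (c h) N j m a} ≤
      #{h ∈ s | ∃ a, 1 ≤ a ∧ NegAt (v h) (c h) N j m a} := by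
    refine card_le_card_of_witness (fun h a => NegAt (v h) (c h) N j m a) (fun a ha => ?_)
      (fun h hh a a' => NegAt.level_unique hD)
    obtain ⟨h1, h, hs, h2⟩ := Finset.mem_filter.1 ha
    exact ⟨h, Finset.mem_filter.2 ⟨hs, a, (Finset.mem_Ico.1 h1).1, h2⟩, h2⟩
  have h2 : #{a ∈ Ico 1 b | ∃ h ∈ s, PosAt (v h) (c h) N j m a} ≤
      #{h ∈ s | ∃ a < b, PosAt (v h) (c h) N j m a} := by
    refine card_le_card_of_witness (fun h a => PosAt (v h) (c h) N j m a) (fun a ha => ?_)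
      (fun h hh a a' => PosAt.level_unique hD)
    obtain ⟨h1, h, hs, h2⟩ := Finset.mem_filter.1 ha
    exact ⟨h, Finset.mem_filter.2 ⟨hs, a, (Finset.mem_Ico.1 h1).2, h2⟩, h2⟩
  have h3 : Ico 1 b ⊆ ({a ∈ Ico 1 b | 1 ≤ levelCount N s v c j a} ∪
      {a ∈ Ico 1 b | ∃ h ∈ s, NegAt (v h) (c h) N j m a}) ∪
      {a ∈ Ico 1 b | ∃ h ∈ s, PosAt (v h) (c h) N j m a} := fun a ha => by
    by_contra hcon
    simp only [mem_union, mem_filter, ha, true_and, not_or, not_exists, not_and] at hcon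
    obtain ⟨h4, h5⟩ := Finset.mem_Ico.1 ha
    exact hb a h4 h5 ⟨by omega, fun h hh => ⟨hcon.2 h hh, hcon.1.2 h hh⟩⟩
  have h4 := (Finset.card_le_card h3).trans (Finset.card_union_le _ _)
  have h5 := Finset.card_union_le {a ∈ Ico 1 b | 1 ≤ levelCount N s v c j a}
      {a ∈ Ico 1 b | ∃ h ∈ s, NegAt (v h) (c h) N j m a}
  rw [Nat.card_Ico] at h4
  omega

/-- The slice x l = 0, x j = b costs t * b in the bound. The discarded members make up for this up
to a constant, since every intercept below b is used for each of t partners of j; levels of x j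
alone serve all t partners at once, and `hlev` pays for them. -/
theorem IsCover.slope_step {D t : ℕ} {K K' : ℝ} (hB : BoundWith D k t K) (hK : 0 ≤ K)
    (hD : Fintype.card ι = D + 2) (hD2 : 2 ≤ D) (htD : t ≤ D + 1) (ht : 1 ≤ t)
    (hC : IsCover N (k + (t - 1)) s v c) (hw : ∀ i, levelCount N s v c i 0 ≤ t - 1)
    (hlev : ∀ j, ∀ A : Finset ℕ, (∀ a ∈ A, 1 ≤ levelCount N s v c j a) →
      (t : ℝ) * #A ≤ 2 * coordCount s v j + K') :
    t * (N : ℝ) - (K + K' + t) ≤ #s := by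
  have hD4 : 4 ≤ Fintype.card ι := by omega
  obtain ⟨o⟩ : Nonempty ι := Fintype.card_pos_iff.1 (by omega)
  -- Minimality lets the discarded members counted at l pay for the same count at j, whichever l the
  -- choice of b produces.
  obtain ⟨j, -, hj⟩ := Finset.exists_min_image univ
    (fun i => coordCount s v i + #(negSet N s v c i)) ⟨o, mem_univ o⟩
  -- The value N + 1 is a fallback, for which the bound on the slice is trivial.
  have hex : ∃ b, 1 ≤ b ∧ (b = N + 1 ∨ ∃ l, j ≠ l ∧ Uncovered N s v c j l b) :=
    ⟨N + 1, by omega, Or.inl rfl⟩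
  obtain ⟨hb1, hb⟩ := Nat.find_spec hex
  have hmin : ∀ m, j ≠ m → ∀ a, 1 ≤ a → a < Nat.find hex → ¬ Uncovered N s v c j m a :=
    fun m hm a h1 h2 h3 => Nat.find_min hex h2 ⟨h1, Or.inr ⟨m, hm, h3⟩⟩
  set b := Nat.find hex with hbdef
  have hl : ∃ l, j ≠ l ∧ (b = N + 1 ∨ b ≤ N ∧ Uncovered N s v c j l b) := by
    rcases hb with hb | ⟨l, hl, hu⟩
    · obtain ⟨l, hl, -⟩ := exists_ne_ne (by omega) j j
      exact ⟨l, hl.symm, Or.inl hb⟩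
    · have : b ≤ N + 1 := Nat.find_min' hex ⟨by omega, Or.inl rfl⟩
      rcases this.lt_or_eq with h | h
      · exact ⟨l, hl, Or.inr ⟨by omega, hu⟩⟩
      · exact ⟨l, hl, Or.inl h⟩
  obtain ⟨l, hjl, hb⟩ := hl
  obtain ⟨T, hlT, hTj, hTcard⟩ := Finset.exists_subsuperset_card_eq
    (s := {l}) (t := univ.erase j) (n := t) (by simp [hjl.symm]) (by simpa using ht)
    (by rw [Finset.card_erase_of_mem (mem_univ j), Finset.card_univ]; omega)
  have hjT : j ∉ T := fun h => by simpa using hTj h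
  have hdis := hC.card_discarded hD4 hjl b hjT
  have hmain : t * ((N : ℝ) - b) - K ≤ (#s : ℝ) - #(discarded N s v c j l b T) := by
    rcases hb with hb | ⟨hbN, hu⟩
    · have h1 : (#(discarded N s v c j l b T) : ℝ) ≤ #s := by
        exact_mod_cast Finset.card_le_card discarded_subset
      have h2 : (0 : ℝ) ≤ t := Nat.cast_nonneg t
      have h3 : t * ((N : ℝ) - (N + 1)) = -t := by ring
      rw [hb, Nat.cast_add, Nat.cast_one, h3]
      rw [hb] at h1
      linarith
    · refine hC.le_sub_card hB hD hjl hbN hu (hw l) discarded_subset fun h hh => ?_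
      simp only [discarded, mem_union, mem_filter, mem_biUnion] at hh
      rcases hh with (⟨-, h1⟩ | ⟨-, h1⟩) | (h1 | ⟨m, hm, -, h1⟩)
      · exact Or.inl h1
      · exact Or.inr (Or.inl h1)
      · exact Or.inr (Or.inr (Or.inl h1))
      · exact Or.inr (Or.inr (Or.inr ⟨m, fun h => hjT (h ▸ hm), h1⟩))
  have hsum : t * (b - 1) ≤ t * #{a ∈ Ico 1 b | 1 ≤ levelCount N s v c j a} +
      #(negSet N s v c j) + ∑ m ∈ T, #{h ∈ s | ∃ a < b, PosAt (v h) (c h) N j m a} := by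
    have h1 := Finset.sum_le_sum fun m (hm : m ∈ T) =>
      sub_one_le_of_covered (s := s) (v := v) (c := c) (N := N) (by omega)
        (hmin m fun h => hjT (h ▸ hm))
    simp only [Finset.sum_add_distrib, Finset.sum_const, hTcard, smul_eq_mul] at h1
    have h2 := sum_card_negAt_le (N := N) (s := s) (v := v) (c := c) hD4 hjT
    omega
  have hlev1 := hlev j {a ∈ Ico 1 b | 1 ≤ levelCount N s v c j a}
    fun a ha => (Finset.mem_filter.1 ha).2
  have hjl' := hj l (mem_univ l)
  have h3 : (t : ℝ) * (b - 1) ≤ t * #{a ∈ Ico 1 b | 1 ≤ levelCount N s v c j a} +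
      #(negSet N s v c j) +
      (∑ m ∈ T, #{h ∈ s | ∃ a < b, PosAt (v h) (c h) N j m a} : ℕ) := by
    have := (Nat.cast_le (α := ℝ)).2 hsum
    rw [Nat.cast_mul, Nat.cast_sub hb1] at this
    exact_mod_cast this
  have h4 : (coordCount s v j : ℝ) + #(negSet N s v c j) ≤
      coordCount s v l + #(negSet N s v c l) := by exact_mod_cast hjl'
  rw [hdis] at hmain
  simp only [Nat.cast_add] at hmain h3
  linarith

/-- For a lower bound of slope `t` one may assume that no member `x i = 0` occurs `t` times. -/
theorem boundWith_of_levelCount_lt {D t : ℕ} {K : ℝ} (hK : 0 ≤ K)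
    (H : ∀ (ι κ : Type) [Fintype ι] (s : Finset κ) (v : κ → ι → ℝ) (c : κ → ℝ) (N : ℕ),
      Fintype.card ι = D → IsCover N k s v c → (∀ i, levelCount N s v c i 0 < t) →
      t * (N : ℝ) - K ≤ #s) : BoundWith D k t K := by
  intro ι κ _ s v c N hD hC
  induction N generalizing s c with
  | zero =>
    have : (0 : ℝ) ≤ #s := Nat.cast_nonneg _
    simp only [Nat.cast_zero, mul_zero]
    linarith
  | succ N ih =>
    by_cases hw : ∀ i, levelCount (N + 1) s v c i 0 < t
    · exact H ι κ s v c (N + 1) hD hC hw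
    -- Peeling off a side that occurs t times lowers N by one and removes at least t members, in
    -- accordance with slope t.
    · push Not at hw
      obtain ⟨i, hi⟩ := hw
      have h1 := ih _ _ (hC.peel i)
      have h2 : levelCount (N + 1) s v c i 0 +
          #{h ∈ s | ¬ CoordAt (v h) (c h) (N + 1) i 0} = #s :=
        Finset.card_filter_add_card_filter_not _
      have h3 : (t : ℝ) + #{h ∈ s | ¬ CoordAt (v h) (c h) (N + 1) i 0} ≤ #s := by
        exact_mod_cast (Nat.add_le_add_right hi _).trans h2.le
      push_cast
      linarith

/-! ### The boundary lines of slope 2 and slope 3. -/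

theorem hasSlope_two (k : ℕ) : HasSlope 2 k k := ⟨0, le_rfl, boundWith_two k⟩

theorem HasSlope.step_two {D k : ℕ} (hD : 2 ≤ D) (h : HasSlope D k (2 : ℕ)) :
    HasSlope (D + 2) (k + 1) (2 : ℕ) := by
  obtain ⟨K, hK, hB⟩ := h
  refine ⟨K + 0 + (2 : ℕ), by positivity, boundWith_of_levelCount_lt (by positivity) ?_⟩
  intro ι κ _ s v c N hD' hC hw
  refine hC.slope_step (t := 2) hB hK hD' hD (by omega) (by omega)
    (fun i => Nat.le_of_lt_succ (hw i)) fun j A hA => ?_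
  have h1 := hC.sum_levelCount_le j A
  have h2 : #A ≤ ∑ a ∈ A, levelCount N s v c j a := by
    rw [Finset.card_eq_sum_ones]; exact Finset.sum_le_sum hA
  have h3 : (#A : ℝ) ≤ coordCount s v j := by exact_mod_cast h2.trans h1
  push_cast
  linarith

/-- Levels below b carry two members, so they can be charged once for A and once for `range b`. -/
theorem IsCover.card_add_le (hC : IsCover N k s v c) (j : ι) (A : Finset ℕ) {b : ℕ}
    (hA : ∀ a ∈ A, 1 ≤ levelCount N s v c j a) (hb : ∀ a < b, 2 ≤ levelCount N s v c j a) :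
    #A + b ≤ coordCount s v j := by
  have h1 := hC.sum_levelCount_le j (A ∪ range b)
  have h2 : ∑ a ∈ A ∪ range b, ((if a ∈ A then 1 else 0) + if a ∈ range b then 1 else 0) ≤
      ∑ a ∈ A ∪ range b, levelCount N s v c j a := by
    refine Finset.sum_le_sum fun a ha => ?_
    by_cases h3 : a ∈ range b
    · have := hb a (Finset.mem_range.1 h3)
      split_ifs <;> omega
    · have h4 : a ∈ A := (Finset.mem_union.1 ha).resolve_right h3
      simpa [h3, h4] using hA a h4
  rw [Finset.sum_add_distrib, ← Finset.sum_filter, ← Finset.sum_filter] at h2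
  have h3 : {a ∈ A ∪ range b | a ∈ A} = A := by
    rw [Finset.filter_mem_eq_inter]; exact Finset.inter_eq_right.2 Finset.subset_union_left
  have h4 : {a ∈ A ∪ range b | a ∈ range b} = range b := by
    rw [Finset.filter_mem_eq_inter]; exact Finset.inter_eq_right.2 Finset.subset_union_right
  rw [h3, h4] at h2
  simp only [Finset.sum_const, smul_eq_mul, mul_one, Finset.card_range] at h2
  omega

theorem HasSlope.step_three {D k : ℕ} (hD : 2 ≤ D) (h : HasSlope D k (3 : ℕ))
    (h' : HasSlope (D + 1) (k + 1) (3 : ℕ)) : HasSlope (D + 2) (k + 2) (3 : ℕ) := by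
  obtain ⟨K, hK, hB⟩ := h
  obtain ⟨K', hK', hB'⟩ := h'
  refine ⟨K + K' + (3 : ℕ), by positivity, boundWith_of_levelCount_lt (by positivity) ?_⟩
  intro ι κ _ s v c N hD' hC hw
  -- Assuming the bound fails, the slice at the first level b with at most one member gives M_j ≤
  -- 3b. With #A + b ≤ M_j this yields 3 * #A ≤ 2 * M_j, as `hlev` requires.
  by_contra! hcon
  refine hcon.not_ge (hC.slope_step (t := 3) hB hK hD' hD (by omega) (by omega)
    (fun i => Nat.le_of_lt_succ (hw i)) fun j A hA => ?_)
  have hex : ∃ a, levelCount N s v c j a ≤ 1 := by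
    obtain ⟨a, ha⟩ := hC.exists_levelCount_eq_zero j
    exact ⟨a, by omega⟩
  have h1 := hC.card_add_le j A hA (b := Nat.find hex)
    fun a ha => not_le.1 (Nat.find_min hex ha)
  have h2 := hC.le_sub_coordCount (k := k + 1) (m := 1) hB' (by positivity) hK' hD' j
    (Nat.find_spec hex)
  have h3 : (#A : ℝ) + Nat.find hex ≤ coordCount s v j := by exact_mod_cast h1
  push_cast at *
  linarith

/-- Every side `x i = 0` contains many points that are covered by members other than that side. -/
theorem IsCover.side_bound (hC : IsCover (N + 1) (k + 2) s v c) {i j l : ι} (hij : i ≠ j)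
    (hil : i ≠ l) (hjl : j ≠ l) (huniv : (univ : Finset ι) = {i, j, l})
    (hw : levelCount (N + 1) s v c i 0 ≤ k) :
    2 * N ≤ #{h ∈ s | ((N + 1 : ℕ) * v h j - c h) * ((N + 1 : ℕ) * v h l - c h) < 0} := by
  have hsum : ∀ {M : Type} [AddCommMonoid M] (g : ι → M), ∑ o, g o = g i + (g j + g l) :=
    fun g => by
      rw [huniv, Finset.sum_insert (by simp [hij, hil]), Finset.sum_pair hjl]
  let x : ℕ → ι → ℕ := fun a o => if o = i then 0 else if o = j then a + 1 else N - a
  have hxi : ∀ a, x a i = 0 := fun a => by simp [x]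
  have hxj : ∀ a, x a j = a + 1 := fun a => by simp [x, hij.symm]
  have hxl : ∀ a, x a l = N - a := fun a => by simp [x, hil.symm, hjl.symm]
  have hx : ∀ a < N, ∑ o, x a o = N + 1 := fun a ha => by
    rw [hsum, hxi, hxj, hxl]; omega
  -- The two bracketed factors are the values of the equation at the vertices j and l; they have
  -- opposite signs exactly when the line crosses the open side between them.
  have hzero : ∀ a < N, ∀ h, ∑ o, v h o * x a o = c h →
      ((N + 1 : ℕ) * v h j - c h) * (a + 1 : ℝ) +
        ((N + 1 : ℕ) * v h l - c h) * ((N : ℝ) - a) = 0 := fun a ha h hi => by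
    rw [hsum, hxi, hxj, hxl, Nat.cast_sub ha.le] at hi
    push_cast at hi ⊢
    linear_combination (N + 1 : ℝ) * hi
  have hpos : ∀ a < N, (0 : ℝ) < (N : ℝ) - a := fun a ha => sub_pos.2 (by exact_mod_cast ha)
  have h1 := Finset.card_mul_le_card_mul (s := range N)
    (t := {h ∈ s | ((N + 1 : ℕ) * v h j - c h) * ((N + 1 : ℕ) * v h l - c h) < 0}) (m := 2) (n := 1)
    (fun a h => ∑ o, v h o * x a o = c h)
    (fun a ha => by
      have haN := Finset.mem_range.1 ha
      have h2 := hC.covers (x a) (hx a haN)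
      have h3 : {h ∈ s | ∑ o, v h o * x a o = c h} ⊆ {h ∈ s | CoordAt (v h) (c h) (N + 1) i 0} ∪
          bipartiteAbove (fun a h => ∑ o, v h o * x a o = c h)
          {h ∈ s | ((N + 1 : ℕ) * v h j - c h) * ((N + 1 : ℕ) * v h l - c h) < 0} a := by
        intro h hh
        obtain ⟨hs, hi⟩ := Finset.mem_filter.1 hh
        simp only [bipartiteAbove, mem_union, mem_filter, hs, hi, true_and, and_true]
        -- Without a sign change, a positive combination of the two values vanishes only if both do,
        -- and then the member is the side x i = 0 itself.
        by_contra! hcon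
        have h4 := hzero a haN h hi
        set p := (N + 1 : ℕ) * v h j - c h with hp
        set q := (N + 1 : ℕ) * v h l - c h with hq
        have h5 := hpos a haN
        have h6 : (0 : ℝ) < a + 1 := by positivity
        have h7 : p * p * (a + 1) + p * q * (N - a) = 0 := by linear_combination p * h4
        have h8 : 0 ≤ p * q * (N - a) := mul_nonneg hcon.2 h5.le
        have h9 : p * p * (a + 1) = 0 :=
          le_antisymm (by linarith) (mul_nonneg (mul_self_nonneg p) h6.le)
        have hp0 : p = 0 := mul_self_eq_zero.1 ((mul_eq_zero.1 h9).resolve_right h6.ne')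
        have hq0 : q = 0 := by
          rw [hp0, zero_mul, zero_add] at h4
          exact (mul_eq_zero.1 h4).resolve_right h5.ne'
        have hN : ((N + 1 : ℕ) : ℝ) ≠ 0 := by positivity
        refine hcon.1 ⟨v h j, fun o ho => ?_, ?_⟩
        · have := Finset.mem_univ o
          rw [huniv] at this
          simp only [mem_insert, mem_singleton, ho, false_or] at this
          rcases this with rfl | rfl
          · rfl
          · exact mul_left_cancel₀ hN (by linarith)
        · push_cast at *
          linarith
      have h4 := (Finset.card_le_card h3).trans (Finset.card_union_le _ _)
      have h5 : #{h ∈ s | CoordAt (v h) (c h) (N + 1) i 0} ≤ k := hw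
      omega)
    (fun h hh => by
      refine Finset.card_le_one.2 fun a ha b hb => ?_
      simp only [bipartiteBelow, mem_filter, mem_range] at ha hb
      have h2 := hzero a ha.1 h ha.2
      have h3 := hzero b hb.1 h hb.2
      have h0 := (Finset.mem_filter.1 hh).2
      set p := (N + 1 : ℕ) * v h j - c h with hp
      set q := (N + 1 : ℕ) * v h l - c h with hq
      have hpq : p - q ≠ 0 := fun h4 => by
        rw [sub_eq_zero.1 h4] at h0
        exact absurd h0 (not_lt.2 (mul_self_nonneg q))
      have h5 : (p - q) * (a : ℝ) = (p - q) * b := by linarith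
      exact_mod_cast mul_left_cancel₀ hpq h5)
  rw [Finset.card_range] at h1
  omega

/-- Each side of the triangle is used at most twice, so its inner points need two further lines
each. A line crosses at most two open sides, as three sign products cannot all be negative; hence 3
* 2N ≤ 2S. -/
theorem hasSlope_three_four : HasSlope 3 4 (3 : ℕ) := by
  refine ⟨3, by norm_num, boundWith_of_levelCount_lt (by norm_num) ?_⟩
  intro ι κ _ s v c N hD hC hw
  rcases N with _ | N
  · have : (0 : ℝ) ≤ #s := Nat.cast_nonneg _
    push_cast
    linarith
  rw [← Finset.card_univ, Finset.card_eq_three] at hD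
  obtain ⟨i, j, l, hij, hil, hjl, huniv⟩ := hD
  have hw' := fun o => Nat.le_of_lt_succ (hw o)
  have h1 := hC.side_bound hij hil hjl huniv (hw' i)
  have h2 := hC.side_bound hjl hij.symm hil.symm
    (by rw [huniv]; ext o; simp only [mem_insert, mem_singleton]; tauto) (hw' j)
  have h3 := hC.side_bound hil.symm hjl.symm hij
    (by rw [huniv]; ext o; simp only [mem_insert, mem_singleton]; tauto) (hw' l)
  set u : κ → ι → ℝ := fun h o => (N + 1 : ℕ) * v h o - c h with hu
  have h4 : #{h ∈ s | u h j * u h l < 0} + #{h ∈ s | u h l * u h i < 0} +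
      #{h ∈ s | u h i * u h j < 0} ≤ 2 * #s := by
    rw [Finset.card_filter, Finset.card_filter, Finset.card_filter, ← Finset.sum_add_distrib,
      ← Finset.sum_add_distrib, mul_comm, ← smul_eq_mul, ← Finset.sum_const]
    refine Finset.sum_le_sum fun h _ => ?_
    by_cases h5 : u h j * u h l < 0
    · by_cases h6 : u h l * u h i < 0
      · have h7 : ¬ u h i * u h j < 0 := fun h7 => by
          have h8 := mul_neg_of_pos_of_neg (mul_pos_of_neg_of_neg h5 h6) h7
          have h9 : u h j * u h l * (u h l * u h i) * (u h i * u h j) =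
            (u h i * u h j * u h l) ^ 2 := by ring
          rw [h9] at h8
          exact absurd h8 (not_lt.2 (sq_nonneg _))
        simp [h7, h5, h6]
      · simp only [h6, if_false]; split_ifs <;> omega
    · simp only [h5, if_false]; split_ifs <;> omega
  have h5 : 2 * N + 2 * N + 2 * N ≤ 2 * #s := le_trans (by gcongr) h4
  have h6 : 3 * N ≤ #s := by omega
  have h7 : (3 : ℝ) * N ≤ #s := by exact_mod_cast h6
  push_cast
  linarith

theorem hasSlope_tie_two (k : ℕ) : HasSlope (2 * k + 2) (k + 2) (2 : ℕ) := by
  induction k with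
  | zero => exact hasSlope_two 2
  | succ k ih => exact ih.step_two (by omega)

theorem hasSlope_tie_three (D : ℕ) : HasSlope (D + 2) (D + 3) (3 : ℕ) := by
  induction D using Nat.twoStepInduction with
  | zero => exact hasSlope_two 3
  | one => exact hasSlope_three_four
  | more D ih ih' => exact ih.step_three (by omega) ih'

/-! ### General slopes from slices of codimension one. -/

theorem IsCover.card_mul_le (hC : IsCover N k s v c) (hD : 3 ≤ Fintype.card ι) {r : ℝ}
    (hr : ∀ j, r ≤ coordCount s v j) : Fintype.card ι * r ≤ #s := by
  have h1 : ∑ _j : ι, r ≤ ∑ j, (coordCount s v j : ℝ) := Finset.sum_le_sum fun j _ => hr j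
  have h2 : ((∑ j, coordCount s v j : ℕ) : ℝ) ≤ #s := by exact_mod_cast hC.sum_coordCount_le hD
  rw [Finset.sum_const, Finset.card_univ, nsmul_eq_mul] at h1
  push_cast at h2
  exact h1.trans h2

/-- For each j, a ≤ M_j and σ(N - a) - K ≤ S - M_j bound M_j below in terms of S; summing over j
bounds S. -/
theorem HasSlope.step_one {D : ℕ} {σ : ℝ} (hD : 2 ≤ D) (hσ : 1 < σ) (h : HasSlope D k σ) :
    HasSlope (D + 1) k ((D + 1) * σ / (σ + D)) := by
  obtain ⟨K, hK, hB⟩ := h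
  have hden : 0 < σ + D := by positivity
  refine ⟨(D + 1) * K / (σ + D), by positivity, ?_⟩
  intro ι κ _ s v c N hD' hC
  have h1 : ∀ j, (σ * N - #s - K) / (σ - 1) ≤ coordCount s v j := fun j => by
    have hex := hC.exists_levelCount_eq_zero j
    have h2 := hC.card_add_le j (range (Nat.find hex)) (b := 0)
      (fun a ha => Nat.one_le_iff_ne_zero.2 (Nat.find_min hex (Finset.mem_range.1 ha)))
      (fun a ha => by omega)
    rw [Finset.card_range, add_zero] at h2
    have h3 : (Nat.find hex : ℝ) ≤ coordCount s v j := by exact_mod_cast h2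
    have h4 := hC.le_sub_coordCount (k := k) (m := 0) hB (by linarith) hK hD' j
      (Nat.find_spec hex).le
    rw [div_le_iff₀ (by linarith)]
    nlinarith
  have h2 := hC.card_mul_le (by omega) h1
  rw [hD', ← mul_div_assoc, div_le_iff₀ (by linarith)] at h2
  rw [div_mul_eq_mul_div, ← sub_div, div_le_iff₀ hden]
  push_cast at h2
  linarith

/-- The first levels with at most one and with no member sum to at most M_j. Dividing the two slice
bounds by σ and σ' lets them be added. -/
theorem HasSlope.step_mixed {D : ℕ} {σ σ' : ℝ} (hD : 2 ≤ D) (hσ : 0 < σ) (hσ' : 0 < σ')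
    (hτ : 1 / σ + 1 / σ' < 1) (h : HasSlope D k σ) (h' : HasSlope D (k + 1) σ') :
    HasSlope (D + 1) (k + 1) ((D + 1) * 2 / (1 + D * (1 / σ + 1 / σ'))) := by
  obtain ⟨K, hK, hB⟩ := h
  obtain ⟨K', hK', hB'⟩ := h'
  set τ := 1 / σ + 1 / σ' with hτdef
  have hτ0 : 0 < τ := by positivity
  have hden : 0 < 1 + D * τ := by positivity
  refine ⟨(D + 1) * (K / σ + K' / σ') / (1 + D * τ), by positivity, ?_⟩
  intro ι κ _ s v c N hD' hC
  have h1 : ∀ j, (2 * N - τ * #s - (K / σ + K' / σ')) / (1 - τ) ≤ coordCount s v j := fun j => by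
    have hex' := hC.exists_levelCount_eq_zero j
    have hex : ∃ a, levelCount N s v c j a ≤ 1 := hex'.imp fun a ha => by omega
    have h2 := hC.card_add_le j (range (Nat.find hex')) (b := Nat.find hex)
      (fun a ha => Nat.one_le_iff_ne_zero.2 (Nat.find_min hex' (Finset.mem_range.1 ha)))
      (fun a ha => not_le.1 (Nat.find_min hex ha))
    rw [Finset.card_range] at h2
    have h3 : (Nat.find hex' : ℝ) + Nat.find hex ≤ coordCount s v j := by exact_mod_cast h2
    have h4 := hC.le_sub_coordCount (k := k) (m := 1) hB hσ.le hK hD' j (Nat.find_spec hex)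
    have h5 := hC.le_sub_coordCount (k := k + 1) (m := 0) hB' hσ'.le hK' hD' j
      (Nat.find_spec hex').le
    set S : ℝ := (#s : ℝ)
    set M : ℝ := (coordCount s v j : ℝ)
    have h6 : (N : ℝ) - Nat.find hex - K / σ ≤ (S - M) / σ := by
      rw [le_div_iff₀ hσ, sub_mul, div_mul_cancel₀ _ hσ.ne']; linarith
    have h7 : (N : ℝ) - Nat.find hex' - K' / σ' ≤ (S - M) / σ' := by
      rw [le_div_iff₀ hσ', sub_mul, div_mul_cancel₀ _ hσ'.ne']; linarith
    have h8 : (S - M) / σ + (S - M) / σ' = τ * (S - M) := by rw [hτdef]; ring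
    rw [div_le_iff₀ (by linarith)]
    nlinarith
  have h2 := hC.card_mul_le (by omega) h1
  rw [hD', ← mul_div_assoc, div_le_iff₀ (by linarith)] at h2
  rw [div_mul_eq_mul_div, ← sub_div, div_le_iff₀ hden]
  push_cast at h2
  linarith

theorem hasSlope_of_le (k e : ℕ) :
    HasSlope (2 * k + 2 + e) (k + 2) ((2 * k + 2 + e : ℝ) / (k + e + 1)) := by
  induction e with
  | zero =>
    convert hasSlope_tie_two k using 1
    have : (k : ℝ) + 1 ≠ 0 := by positivity
    push_cast
    field_simp
    ring
  | succ e ih =>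
    have h0 : (0 : ℝ) < k + e + 1 := by positivity
    have h := ih.step_one (by omega) (by rw [lt_div_iff₀ h0]; linarith [k.cast_nonneg (α := ℝ)])
    rw [← add_assoc]
    convert h using 1
    have h1 : (k : ℝ) + e + 2 ≠ 0 := by positivity
    have h2 : 2 * (k : ℝ) + 2 + e ≠ 0 := by positivity
    have h3 : (2 * (k : ℝ) + 2 + e) / (k + e + 1) + ((2 * k + 2 + e : ℕ) : ℝ) =
        (2 * (k : ℝ) + 2 + e) * (k + e + 2) / (k + e + 1) := by
      push_cast; field_simp; ring
    rw [h3]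
    push_cast
    field_simp
    ring

theorem hasSlope_of_ge (D : ℕ) : ∀ k, 2 ≤ k → k ≤ D + 1 → D + 2 ≤ 2 * k → 2 ≤ D →
    HasSlope D k (3 * D / (2 * D - k + 1)) := by
  induction D with
  | zero => intro k _ _ _ h; omega
  | succ D ih =>
    intro k hk hkD hDk hD
    rcases hkD.eq_or_lt with rfl | hkD
    · obtain ⟨D, rfl⟩ := Nat.exists_eq_add_of_le' (show 1 ≤ D by omega)
      convert hasSlope_tie_three D using 1
      have : (D : ℝ) + 2 ≠ 0 := by positivity
      push_cast
      rw [div_eq_iff (by ring_nf; positivity)]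
      ring
    rcases hDk.eq_or_lt with hDk | hDk
    · obtain ⟨k, rfl⟩ := Nat.exists_eq_add_of_le' hk
      obtain rfl : D = 2 * k + 1 := by omega
      convert hasSlope_tie_two k using 1
      push_cast
      rw [div_eq_iff (by ring_nf; positivity)]
      ring
    -- Strictly between the boundary lines, both multiplicities one dimension lower are in range.
    · obtain ⟨k, rfl⟩ := Nat.exists_eq_add_of_le' (show 1 ≤ k by omega)
      have h := ih k (by omega) (by omega) (by omega) (by omega)
      have h' := ih (k + 1) (by omega) (by omega) (by omega) (by omega)
      have h1 : (k : ℝ) ≤ D := by exact_mod_cast (show k ≤ D by omega)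
      have h2 : (D : ℝ) + 2 ≤ 2 * k := by exact_mod_cast (show D + 2 ≤ 2 * k by omega)
      have hD0 : (2 : ℝ) ≤ D := by exact_mod_cast (show 2 ≤ D by omega)
      have h3 : (0 : ℝ) < 2 * D - k + 1 := by linarith
      have h4 : (0 : ℝ) < 2 * D - k := by linarith
      push_cast at h'
      have h5 : (2 * (D : ℝ) - (k + 1) + 1) = 2 * D - k := by ring
      rw [h5] at h'
      have hτ : 1 / (3 * (D : ℝ) / (2 * D - k + 1)) + 1 / (3 * D / (2 * D - k)) =
          (4 * D - 2 * k + 1) / (3 * D) := by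
        field_simp; ring
      have h6 := h.step_mixed (by omega) (by positivity) (by positivity)
        (by rw [hτ, div_lt_one (by positivity)]; linarith) h'
      convert h6 using 1
      rw [hτ]
      have h7 : 1 + (D : ℝ) * ((4 * D - 2 * k + 1) / (3 * D)) = (4 * D - 2 * k + 4) / 3 := by
        field_simp; ring
      rw [h7]
      push_cast
      rw [div_eq_div_iff (by linarith) (by linarith)]
      ring

end LowerBound
end TriangularGrid

/-! ### Return to `f` and covers parallel to the facets. -/

namespace TriangularGrid
section Conversion

open Finset
open scoped Classical

variable {n d k : ℕ}

theorem coverCount_map {α : Type*} (S : Finset α) (H : α → Set (Fin d → ℝ)) (p : Fin d → ℝ) :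
    coverCount (S.val.map H) p = #{h ∈ S | p ∈ H h} := by
  rw [coverCount, Multiset.countP_map]
  rfl

theorem le_f_of_boundWith {σ K : ℝ} (hd : 1 ≤ d) (hn : 1 ≤ n) (hB : BoundWith (d + 1) k σ K) :
    σ * ((n : ℝ) - 1) - K ≤ f n d k := by
  obtain ⟨C, ⟨hH, hC⟩, hcard⟩ := exists_isKCover n d k hd
  choose v c hv hvc using fun h : C => hH h (Multiset.coe_mem)
  -- The extra coordinate gets coefficient 0, so a nonzero normal vector becomes nonconstant.
  -- Indexing by the multiset keeps multiplicities.
  have hcov : IsCover (ι := Option (Fin d)) (n - 1) k (univ : Finset C)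
      (fun h o => o.elim 0 (v h)) c := by
    refine ⟨fun h _ => ?_, fun x hx => ?_⟩
    · obtain ⟨i, hi⟩ := Function.ne_iff.1 (hv h)
      exact ⟨some i, none, hi⟩
    · rw [Fintype.sum_option] at hx
      have h1 := hC (fun i => (x (some i) : ℝ)) ⟨fun i => x (some i),
        show ∑ i, x (some i) < n by omega, rfl⟩
      rw [← Multiset.map_univ_coe C, coverCount_map] at h1
      convert h1 using 4 with h
      rw [hvc h, Fintype.sum_option]
      simp
  have h2 := hB.le (by simp) hcov
  rw [Finset.card_univ, Multiset.card_coe, hcard, Nat.cast_sub hn] at h2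
  exact_mod_cast h2

/-- The hyperplanes `x i = j` and `∑ i, x i = n - 1 - j` parallel to the facets of the simplex. -/
def facetPlane (n d : ℕ) : Option (Fin d) × ℕ → Set (Fin d → ℝ)
  | (none, j) => {x | ∑ i, (1 : Fin d → ℝ) i * x i = (n : ℝ) - 1 - j}
  | (some i, j) => {x | ∑ l, (Pi.single i 1 : Fin d → ℝ) l * x l = j}

/-- The first `a` hyperplanes parallel to each facet. -/
def facetPlanes (n d a : ℕ) : Multiset (Set (Fin d → ℝ)) :=
  ((univ : Finset (Option (Fin d))) ×ˢ range a).val.map (facetPlane n d)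

theorem card_facetPlanes (n d a : ℕ) : Multiset.card (facetPlanes n d a) = (d + 1) * a := by
  simp [facetPlanes]

theorem isHyperplane_of_mem_facetPlanes (hd : 1 ≤ d) {a : ℕ} {H : Set (Fin d → ℝ)}
    (hH : H ∈ facetPlanes n d a) : IsHyperplane H := by
  obtain ⟨⟨o, j⟩, -, rfl⟩ := Multiset.mem_map.1 hH
  rcases o with _ | i
  · refine ⟨1, _, fun h => ?_, rfl⟩
    exact one_ne_zero (congrFun h ⟨0, hd⟩)
  · exact ⟨Pi.single i 1, _, by simp, rfl⟩

/-- The homogeneous coordinates of a grid point. -/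
def homog (n : ℕ) (x : Fin d → ℕ) : Option (Fin d) → ℕ := fun o => o.elim (n - 1 - ∑ i, x i) x

theorem sum_homog {x : Fin d → ℕ} (hx : ∑ i, x i < n) : ∑ o, homog n x o = n - 1 := by
  rw [Fintype.sum_option]
  simp only [homog, Option.elim]
  omega

theorem card_le_coverCount_facetPlanes {x : Fin d → ℕ} (hx : ∑ i, x i < n) (a : ℕ) :
    #{o | homog n x o < a} ≤ coverCount (facetPlanes n d a) fun i => (x i : ℝ) := by
  rw [facetPlanes, coverCount_map]
  refine Finset.card_le_card_of_injOn (fun o => (o, homog n x o)) (fun o ho => ?_)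
    fun o _ o' _ h => congrArg Prod.fst h
  have h1 := (Finset.mem_filter.1 ho).2
  simp only [coe_filter, Set.mem_ofPred_eq, mem_product, mem_univ, mem_range, true_and, h1]
  rcases o with _ | i
  · simp only [facetPlane, homog, Option.elim, Set.mem_ofPred_eq, Pi.one_apply, one_mul]
    rw [Nat.cast_sub (by omega), Nat.cast_sub (by omega)]
    push_cast
    ring
  · simp [facetPlane, homog, Pi.single_apply]

theorem coverCount_add (C C' : Multiset (Set (Fin d → ℝ))) (p : Fin d → ℝ) :
    coverCount (C + C') p = coverCount C p + coverCount C' p := Multiset.countP_add _ _ _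

theorem card_lt_add_card_ge (x : Fin d → ℕ) (n a : ℕ) :
    #{o | homog n x o < a} + #{o | a ≤ homog n x o} = d + 1 := by
  have h := Finset.card_filter_add_card_filter_not (s := (univ : Finset (Option (Fin d))))
    (fun o => homog n x o < a)
  simp only [not_lt] at h
  rw [h]
  simp

/-- Covering by the first `a` and again by the first `b` hyperplanes parallel to each facet. -/
theorem f_le_of_card (hd : 1 ≤ d) (a b : ℕ)
    (h : ∀ x : Fin d → ℕ, ∑ i, x i < n →
      #{o | a ≤ homog n x o} + #{o | b ≤ homog n x o} + k ≤ 2 * (d + 1)) :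
    f n d k ≤ (d + 1) * (a + b) := by
  refine Nat.sInf_le ⟨facetPlanes n d a + facetPlanes n d b, ⟨fun H hH => ?_, ?_⟩, ?_⟩
  · rcases Multiset.mem_add.1 hH with h1 | h1 <;> exact isHyperplane_of_mem_facetPlanes hd h1
  · rintro p ⟨x, hx, rfl⟩
    rw [coverCount_add]
    have h1 := card_le_coverCount_facetPlanes hx a
    have h2 := card_le_coverCount_facetPlanes hx b
    have h3 := card_lt_add_card_ge x n a
    have h4 := card_lt_add_card_ge x n b
    have h5 := h x hx
    omega
  · rw [Multiset.card_add, card_facetPlanes, card_facetPlanes]; ring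

theorem f_le_one_layer (hd : 1 ≤ d) (hk : k ≤ d + 1) :
    f n d k ≤ (d + 1) * (n / (d + 2 - k) + 1) := by
  -- The second layer is empty.
  refine f_le_of_card hd (n / (d + 2 - k) + 1) 0 fun x hx => ?_
  set q := d + 2 - k with hq
  have h1 : #{o | n / q + 1 ≤ homog n x o} * (n / q + 1) ≤ ∑ o, homog n x o := by
    rw [← smul_eq_mul]
    refine (Finset.card_nsmul_le_sum _ _ _ fun o ho => (Finset.mem_filter.1 ho).2).trans ?_
    exact Finset.sum_le_sum_of_subset (Finset.filter_subset _ _)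
  rw [sum_homog hx] at h1
  have h2 : n < q * (n / q + 1) := Nat.lt_mul_div_succ n (by omega)
  have h3 : #{o | n / q + 1 ≤ homog n x o} < q := by
    by_contra! hcon
    have := Nat.mul_le_mul_right (n / q + 1) hcon
    omega
  simp only [Nat.zero_le, Finset.filter_true, Finset.card_univ, Fintype.card_option,
    Fintype.card_fin]
  omega

theorem f_le_two_layers (hd : 1 ≤ d) (hk : k ≤ 2 * (d + 1)) :
    f n d k ≤ (d + 1) * (3 * (n / (2 * d + 3 - k) + 1)) := by
  set q := 2 * d + 3 - k with hq
  set α := n / q + 1 with hα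
  refine (f_le_of_card hd α (2 * α) fun x hx => ?_).trans (by apply le_of_eq; ring)
  -- A coordinate is at least α times the number of the thresholds α and 2α that it reaches.
  have h1 : #{o | α ≤ homog n x o} * α + #{o | 2 * α ≤ homog n x o} * α ≤ ∑ o, homog n x o := by
    rw [Finset.card_filter, Finset.card_filter, Finset.sum_mul, Finset.sum_mul,
      ← Finset.sum_add_distrib]
    refine Finset.sum_le_sum fun o _ => ?_
    split_ifs <;> omega
  rw [sum_homog hx, ← add_mul] at h1
  have h2 : n < q * α := Nat.lt_mul_div_succ n (by omega)
  have h3 : #{o | α ≤ homog n x o} + #{o | 2 * α ≤ homog n x o} < q := by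
    by_contra! hcon
    have := Nat.mul_le_mul_right α hcon
    omega
  omega

theorem isBigO_f_sub {σ K' : ℝ} (hd : 1 ≤ d) (hB : HasSlope (d + 1) k σ)
    (hU : ∀ n, (f n d k : ℝ) ≤ σ * n + K') :
    (fun n : ℕ => (f n d k : ℝ) - σ * n) =O[Filter.atTop] (fun _ : ℕ => (1 : ℝ)) := by
  obtain ⟨K, -, hB⟩ := hB
  refine Asymptotics.IsBigO.of_bound (|K'| + |σ + K|) ?_
  filter_upwards [Filter.eventually_ge_atTop 1] with n hn
  have h1 := le_f_of_boundWith hd hn hB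
  have h2 := hU n
  have h3 := le_abs_self K'
  have h4 := le_abs_self (σ + K)
  have h5 := abs_nonneg K'
  have h6 := abs_nonneg (σ + K)
  rw [norm_one, mul_one, Real.norm_eq_abs, abs_le]
  constructor <;> linarith

end Conversion
end TriangularGrid

theorem theorem3p6 :
    (∀ d k : ℕ, 2 ≤ k → 2 * (k : ℤ) - 3 ≤ (d : ℤ) →
      (fun n : ℕ => (TriangularGrid.f n d k : ℝ)
          - (1 + ((k : ℝ) - 1) / ((d : ℝ) - (k : ℝ) + 2)) * (n : ℝ))
        =O[Filter.atTop] (fun _ : ℕ => (1 : ℝ))) ∧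
    (∀ d k : ℕ, 3 ≤ k → (k : ℤ) - 2 ≤ (d : ℤ) → (d : ℤ) ≤ 2 * (k : ℤ) - 3 →
      (fun n : ℕ => (TriangularGrid.f n d k : ℝ)
          - (2 + (2 * (k : ℝ) - 3 - (d : ℝ)) / (2 * (d : ℝ) + 3 - (k : ℝ))) * (n : ℝ))
        =O[Filter.atTop] (fun _ : ℕ => (1 : ℝ))) := by
  constructor
  · intro d k hk hdk
    obtain ⟨k, rfl⟩ := Nat.exists_eq_add_of_le' hk
    obtain ⟨e, rfl⟩ := Nat.exists_eq_add_of_le (show 2 * k + 1 ≤ d by omega)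
    have h0 : (0 : ℝ) < k + e + 1 := by positivity
    have hσ : 1 + (((k + 2 : ℕ) : ℝ) - 1) / (((2 * k + 1 + e : ℕ) : ℝ) - (k + 2 : ℕ) + 2) =
        (2 * k + 2 + e : ℝ) / (k + e + 1) := by
      have h1 : ((2 * k + 1 + e : ℕ) : ℝ) - (k + 2 : ℕ) + 2 = k + e + 1 := by push_cast; ring
      rw [h1]; push_cast; field_simp; ring
    rw [hσ]
    refine TriangularGrid.isBigO_f_sub (K' := 2 * k + 2 + e) (by omega) ?_ fun n => ?_
    · convert TriangularGrid.hasSlope_of_le k e using 1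
      omega
    · have h1 := TriangularGrid.f_le_one_layer (n := n) (d := 2 * k + 1 + e) (k := k + 2)
        (by omega) (by omega)
      rw [show 2 * k + 1 + e + 2 - (k + 2) = k + e + 1 by omega] at h1
      have h2 : (TriangularGrid.f n (2 * k + 1 + e) (k + 2) : ℝ) ≤
          (2 * k + 1 + e + 1) * ((n / (k + e + 1) : ℕ) + 1) := by exact_mod_cast h1
      have h3 : ((n / (k + e + 1) : ℕ) : ℝ) ≤ (n : ℝ) / (k + e + 1) := by
        simpa using Nat.cast_div_le (α := ℝ) (m := n) (n := k + e + 1)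
      have h4 : (2 * k + 1 + e + 1 : ℝ) * ((n / (k + e + 1) : ℕ) + 1) ≤
          (2 * k + 1 + e + 1) * ((n : ℝ) / (k + e + 1) + 1) := by gcongr
      refine (h2.trans h4).trans (le_of_eq ?_)
      ring
  · intro d k hk hkd hdk
    have hkd' : k ≤ d + 2 := by omega
    have h0 : (k : ℝ) ≤ d + 2 := by exact_mod_cast hkd'
    have hd1 : (1 : ℝ) ≤ d := by exact_mod_cast (show 1 ≤ d by omega)
    have h1 : (0 : ℝ) < 2 * d + 3 - k := by linarith
    have hσ : 2 + (2 * (k : ℝ) - 3 - d) / (2 * d + 3 - k) =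
        3 * ((d + 1 : ℕ) : ℝ) / (2 * ((d + 1 : ℕ) : ℝ) - k + 1) := by
      have h2 : 2 * ((d + 1 : ℕ) : ℝ) - k + 1 = 2 * d + 3 - k := by push_cast; ring
      rw [h2, eq_div_iff h1.ne', add_mul, div_mul_cancel₀ _ h1.ne']
      push_cast
      ring
    rw [hσ]
    refine TriangularGrid.isBigO_f_sub (K' := 3 * (d + 1)) (by omega)
      (TriangularGrid.hasSlope_of_ge (d + 1) k (by omega) (by omega) (by omega) (by omega))
      fun n => ?_
    have h2 := TriangularGrid.f_le_two_layers (n := n) (d := d) (k := k) (by omega) (by omega)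
    have h3 : (TriangularGrid.f n d k : ℝ) ≤
        (d + 1) * (3 * ((n / (2 * d + 3 - k) : ℕ) + 1)) := by exact_mod_cast h2
    have h4 : ((n / (2 * d + 3 - k) : ℕ) : ℝ) ≤ (n : ℝ) / (2 * ((d + 1 : ℕ) : ℝ) - k + 1) := by
      refine (Nat.cast_div_le (α := ℝ) (m := n) (n := 2 * d + 3 - k)).trans (le_of_eq ?_)
      rw [Nat.cast_sub (by omega)]
      push_cast
      ring
    have h5 : (d + 1 : ℝ) * (3 * ((n / (2 * d + 3 - k) : ℕ) + 1)) ≤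
        (d + 1) * (3 * ((n : ℝ) / (2 * ((d + 1 : ℕ) : ℝ) - k + 1) + 1)) := by gcongr
    refine (h3.trans h5).trans (le_of_eq ?_)
    push_cast
    ring
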